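/- A probability measure $\mu$ on $\mathbb{R}^n$ is isotropic if $\mathbb{E}\langle X,y\rangle^2=|y|^2$ for all $y\in\mathbb{R}^n$, where $X$ has law $\mu$, and it is $\psi_2$ with constant $\alpha$ if $\|\langle X,y\rangle\|_{\psi_2}\le\alpha|y|$ for all $y\in\mathbb{R}^n$, where $\|Y\|_{\psi_2}=\inf\{u>0:\mathbb{E}\exp(Y^2/u^2)\le 2\}$. For a real $k\times n$ matrix $\Gamma$ with columns $v_1,\dots,v_n\in\mathbb{R}^k$, let $K^+(\Gamma)=\mathrm{conv}\{v_1,\dots,v_n\}$ and $K(\Gamma)=\mathrm{conv}\{\pm v_1,\dots,\pm v_n\}$. A polytope is $m$-neighborly if any set of less than $m$ of its vertices is the vertex set of a face; a symmetric polytope is $m$-symmetric-neighborly if any set of less than $m$ of its vertices that contains no opposite pair is the vertex set of a face. **Theorem.** (1) There exist absolute constants $c>1$ and $C,\bar c>0$ such that the following holds. Let $1\le k\le n$, let $\alpha\ge 1$, let $\mu$ be an isotropic $\psi_2$ probability measure on $\mathbb{R}^n$ with constant $\alpha$, and let $\Gamma$ be the random $k\times n$ matrix whose rows $X_1,\dots,X_k$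 are independent and distributed according to $\mu$. Then, with probability at least $1-\exp(-\bar c\,k/\alpha^4)$, for every integer $m\ge 0$ satisfying $$m\le\frac{Ck}{\alpha^4\log(cn\alpha^4/k)},$$ the polytope $K^+(\Gamma)$ is $m$-neighborly and the polytope $K(\Gamma)$ is $m$-symmetric-neighborly, and moreover, if $m\ge 2$, these polytopes have exactly $n$ and $2n$ vertices, respectively. (2) This includes random $\pm1$ matrices: there is an absolute constant $\alpha\ge1$ such that, for every $n$, the uniform probability measure on $\{-1,1\}^n$ is isotropic and $\psi_2$ with constant $\alpha$. (3) Consequently, there exist absolute constants $c_1,c_2>0$ and $c_3>1$ such that for $1\le k\le n$, if $\Gamma$ is a random $k\times n$ matrix whose rows are independent and uniformly distributed on $\{-1,1\}^n$, then with probability larger than $1-\exp(-c_1k)$, for every integer $m\ge0$ with $m\le c_2k/\log(c_3n/k)$, the polytope $K^+(\Gamma)$ is $m$-neighborly and $K(\Gamma)$ is $m$-symmetric-neighborly, and if $m\ge 2$, they have exactly $n$ and $2n$ vertices, respectively. -/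

import Mathlib

open MeasureTheory ProbabilityTheory
open scoped ENNReal Pointwise

noncomputable section

/-- The `ψ₂` norm `inf {u > 0 : 𝔼 exp (Y² / u²) ≤ 2}` of a real random variable, with values in
`[0, ∞]` (it is `∞` if there is no such `u`). -/
def psiTwoNorm {Ω : Type*} [MeasurableSpace Ω] (Y : Ω → ℝ) (P : Measure Ω) : ℝ≥0∞ :=
  ⨅ (u : ℝ) (_ : 0 < u)
    (_ : ∫⁻ ω, ENNReal.ofReal (Real.exp ((Y ω) ^ 2 / u ^ 2)) ∂P ≤ 2), ENNReal.ofReal u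

/-- A measure on `ℝⁿ` is isotropic if `𝔼 ⟨X, y⟩² = |y|²` for all `y`, where `X` has law `μ`. -/
def IsIsotropicMeasure {n : ℕ} (μ : Measure (EuclideanSpace ℝ (Fin n))) : Prop :=
  ∀ y : EuclideanSpace ℝ (Fin n), ∫ x, (inner ℝ x y) ^ 2 ∂μ = ‖y‖ ^ 2

/-- The `ψ₂` condition with constant `α`: `‖⟨X, y⟩‖_{ψ₂} ≤ α |y|` for all `y`. -/
def IsPsiTwoMeasure {n : ℕ} (μ : Measure (EuclideanSpace ℝ (Fin n))) (α : ℝ) : Prop :=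
  ∀ y : EuclideanSpace ℝ (Fin n),
    psiTwoNorm (fun x => inner ℝ x y) μ ≤ ENNReal.ofReal (α * ‖y‖)

/-- The uniform probability measure on the combinatorial cube `{-1, 1}ⁿ ⊆ ℝⁿ`. -/
def signCubeMeasure (n : ℕ) : Measure (EuclideanSpace ℝ (Fin n)) :=
  uniformOn {x : EuclideanSpace ℝ (Fin n) | ∀ j, x j = -1 ∨ x j = 1}

/-- The `k × n` matrix with rows `x 0, …, x (k - 1)`. -/
def rowMatrix {k n : ℕ} (x : Fin k → EuclideanSpace ℝ (Fin n)) : Matrix (Fin k) (Fin n) ℝ :=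
  Matrix.of fun i j => x i j

/-- The `j`-th column `v_j = Γ e_j` of `Γ`, a vector of `ℝᵏ`. -/
def columnVector {k n : ℕ} (Γ : Matrix (Fin k) (Fin n) ℝ) (j : Fin n) :
    EuclideanSpace ℝ (Fin k) :=
  WithLp.toLp 2 fun i => Γ i j

/-- `K⁺(Γ)`, the convex hull of the columns of `Γ`. -/
def columnHull {k n : ℕ} (Γ : Matrix (Fin k) (Fin n) ℝ) : Set (EuclideanSpace ℝ (Fin k)) :=
  convexHull ℝ (Set.range (columnVector Γ))

/-- `K(Γ)`, the symmetric convex hull of the columns of `Γ`. -/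
def symmColumnHull {k n : ℕ} (Γ : Matrix (Fin k) (Fin n) ℝ) : Set (EuclideanSpace ℝ (Fin k)) :=
  convexHull ℝ (Set.range (columnVector Γ) ∪ -Set.range (columnVector Γ))

/-- `S` is the vertex set of a face of the polytope `K`. Faces are the exposed subsets: the sets
of maximizers on `K` of a linear functional, and the empty set. -/
def IsVertexSetOfFace {E : Type*} [NormedAddCommGroup E] [NormedSpace ℝ E]
    (K S : Set E) : Prop :=
  ∃ F : Set E, IsExposed ℝ K F ∧ F.extremePoints ℝ = S

/-- Any set of less than `m` vertices of `K` is the vertex set of a face of `K`. -/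
def IsNeighborly {E : Type*} [NormedAddCommGroup E] [NormedSpace ℝ E]
    (m : ℕ) (K : Set E) : Prop :=
  ∀ S : Finset E, (S : Set E) ⊆ K.extremePoints ℝ → S.card < m → IsVertexSetOfFace K (S : Set E)

/-- Any set of less than `m` vertices of `K` without opposite pairs is the vertex set of a face
of `K`. -/
def IsSymmNeighborly {E : Type*} [NormedAddCommGroup E] [NormedSpace ℝ E]
    (m : ℕ) (K : Set E) : Prop :=
  ∀ S : Finset E, (S : Set E) ⊆ K.extremePoints ℝ → S.card < m → (∀ x ∈ S, -x ∉ S) →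
    IsVertexSetOfFace K (S : Set E)

/-- `K⁺(Γ)` is `m`-neighborly and `K(Γ)` is `m`-symmetric-neighborly; moreover, as soon as
`m ≥ 2`, the points `v_j` (respectively `± v_j`) are distinct and are all vertices, that is, the
two polytopes have exactly `n` and `2 n` vertices. -/
def HasNeighborlyHulls {k n : ℕ} (m : ℕ) (Γ : Matrix (Fin k) (Fin n) ℝ) : Prop :=
  IsNeighborly m (columnHull Γ) ∧ IsSymmNeighborly m (symmColumnHull Γ) ∧
    (2 ≤ m → ((columnHull Γ).extremePoints ℝ).ncard = n ∧
      ((symmColumnHull Γ).extremePoints ℝ).ncard = 2 * n)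

end

/-! Both neighborliness claims follow from the null space property of `Γ`: a nonzero kernel vector
carries less than half of its `ℓ₁` mass on any set of fewer than `m` coordinates. By Hahn–Banach
this gives, for each such set and each choice of signs, a functional with the prescribed values `±1`
on the chosen columns and modulus less than `1` on the others
(`HasNullSpaceProperty.exists_functional`); it exposes the required face. Applied to single columns,
it shows that all `v_j`, respectively `±v_j`, are distinct vertices.

The null space property comes from conditioning on a finite set of test vectors: `k/2 |z|² ≤ |Γz|² ≤
2k |z|²` for every sum `z` of exactly `N` signed basis vectors, repetitions allowed. A kernel vector
`x` with `|x|₁ = R` is a mean of points `±R e_j`. By Maurey's empirical method some sum of `N` of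
these makes `|Γz|² - (k/2)|z|²` at most its mean. That mean is a negative term of order `-N² k |x|²`
plus a variance of order `N k R²`, while the test vectors make it nonnegative. Hence `(N - 1)|x|² ≤
4R²`: kernel vectors are spread out, and Cauchy–Schwarz finishes for `N > 16 m`.

For one fixed `z`, the `ψ₂` condition makes `⟨X, z⟩²` subexponential, and Bernstein bounds the
failure probability by `2 exp(-k / (2048 α⁴))`. There are at most `(3en/N)^N` test vectors, so the
union bound permits `N` of order `k / (α⁴ log(c n α⁴ / k))`. -/

/-- The signed basis vector `± e_j` of `ℝⁿ`. -/
noncomputable def signedBasisVector {n : ℕ} (p : Fin n × Bool) : EuclideanSpace ℝ (Fin n) :=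
  EuclideanSpace.single p.1 (if p.2 then 1 else -1)

/-- The sum of a multiset of signed basis vectors. -/
noncomputable def signedSum {n : ℕ} (s : Multiset (Fin n × Bool)) : EuclideanSpace ℝ (Fin n) :=
  (s.map signedBasisVector).sum

/-! ### Maurey's empirical method -/

section Transfer

variable {E F ι : Type*} [NormedAddCommGroup E] [InnerProductSpace ℝ E]
  [NormedAddCommGroup F] [InnerProductSpace ℝ F] [Fintype ι]

/-- Bias–variance identity: the cross term sees only the mean. The variance term does not depend on
the base point `a`, so successive random choices contribute the same amount each. -/
theorem sum_weight_mul_norm_sq_add (w : ι → ℝ) (hw1 : ∑ i, w i = 1) (Z : ι → E) (x : E)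
    (hx : ∑ i, w i • Z i = x) (a : E) :
    ∑ i, w i * ‖a + Z i‖ ^ 2 = ‖a + x‖ ^ 2 + (∑ i, w i * ‖Z i‖ ^ 2 - ‖x‖ ^ 2) := by
  have h : ∑ i, w i * inner ℝ a (Z i) = inner ℝ a x := by
    rw [← hx, inner_sum]
    simp [inner_smul_right]
  simp only [norm_add_sq_real, mul_add, Finset.sum_add_distrib, ← Finset.sum_mul, hw1, ← h]
  simp only [Finset.mul_sum]
  have : ∀ i, w i * (2 * inner ℝ a (Z i)) = 2 * (w i * inner ℝ a (Z i)) := fun i => by ring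
  simp only [this]
  ring

/-- Maurey's empirical method, derandomized by conditional expectations: some sum of `N` of the
points `Z i` makes a difference of two quadratic forms at most its mean. -/
theorem exists_multiset_norm_sq_sub_le (T : E →ₗ[ℝ] F) (κ : ℝ) (w : ι → ℝ) (hw0 : ∀ i, 0 ≤ w i)
    (hw1 : ∑ i, w i = 1) (Z : ι → E) (x : E) (hx : ∑ i, w i • Z i = x) (N : ℕ) (a : E) :
    ∃ s : Multiset ι, s.card = N ∧
      ‖T (a + (s.map Z).sum)‖ ^ 2 - κ * ‖a + (s.map Z).sum‖ ^ 2 ≤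
        ‖T (a + (N : ℝ) • x)‖ ^ 2 - κ * ‖a + (N : ℝ) • x‖ ^ 2 +
          N * (∑ i, w i * (‖T (Z i)‖ ^ 2 - κ * ‖Z i‖ ^ 2) - (‖T x‖ ^ 2 - κ * ‖x‖ ^ 2)) := by
  induction N generalizing a with
  | zero => exact ⟨0, by simp⟩
  | succ N ih =>
    set V := ∑ i, w i * (‖T (Z i)‖ ^ 2 - κ * ‖Z i‖ ^ 2) - (‖T x‖ ^ 2 - κ * ‖x‖ ^ 2) with hV
    have hTx : ∑ i, w i • T (Z i) = T x := by rw [← hx]; simp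
    have key : ∑ i, w i * (‖T (a + (N : ℝ) • x + Z i)‖ ^ 2 - κ * ‖a + (N : ℝ) • x + Z i‖ ^ 2) =
        ‖T (a + (N : ℝ) • x + x)‖ ^ 2 - κ * ‖a + (N : ℝ) • x + x‖ ^ 2 + V := by
      have h1 := sum_weight_mul_norm_sq_add w hw1 Z x hx (a + (N : ℝ) • x)
      have h2 := sum_weight_mul_norm_sq_add w hw1 (fun i => T (Z i)) (T x) hTx
        (T (a + (N : ℝ) • x))
      have e : ∀ f g : ι → ℝ, ∑ i, w i * (f i - κ * g i) =
          ∑ i, w i * f i - κ * ∑ i, w i * g i := fun f g => by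
        rw [Finset.mul_sum, ← Finset.sum_sub_distrib]
        exact Finset.sum_congr rfl fun i _ => by ring
      rw [hV, e, e, h1]
      simp only [← map_add] at h2
      rw [h2]
      ring
    -- Some value does not exceed the weighted mean, so one of the `N + 1` copies of `x` can be
    -- replaced by some `Z i` at cost `V`; the induction hypothesis, with base point `a + Z i`,
    -- replaces the rest.
    obtain ⟨i, hi⟩ : ∃ i, ‖T (a + (N : ℝ) • x + Z i)‖ ^ 2 - κ * ‖a + (N : ℝ) • x + Z i‖ ^ 2 ≤
        ‖T (a + (N : ℝ) • x + x)‖ ^ 2 - κ * ‖a + (N : ℝ) • x + x‖ ^ 2 + V := by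
      by_contra! hcon
      rw [← key] at hcon
      set b := ∑ i, w i * (‖T (a + (N : ℝ) • x + Z i)‖ ^ 2 - κ * ‖a + (N : ℝ) • x + Z i‖ ^ 2)
        with hb
      obtain ⟨j, hj⟩ : ∃ j, 0 < w j := by
        by_contra! h
        have := Finset.sum_nonpos fun i (_ : i ∈ Finset.univ) => h i
        linarith
      have : ∑ i, w i * b < b := by
        conv_rhs => rw [hb]
        exact Finset.sum_lt_sum (fun i _ => mul_le_mul_of_nonneg_left (hcon i).le (hw0 i))
          ⟨j, Finset.mem_univ _, mul_lt_mul_of_pos_left (hcon j) hj⟩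
      rw [← Finset.sum_mul, hw1, one_mul] at this
      exact lt_irrefl _ this
    obtain ⟨s, hs, hle⟩ := ih (a + Z i)
    refine ⟨i ::ₘ s, by simp [hs], ?_⟩
    rw [Multiset.map_cons, Multiset.sum_cons, ← add_assoc]
    refine hle.trans ?_
    have e1 : a + Z i + (N : ℝ) • x = a + (N : ℝ) • x + Z i := by abel
    have e2 : a + ((N + 1 : ℕ) : ℝ) • x = a + (N : ℝ) • x + x := by
      push_cast
      rw [add_smul, one_smul, add_assoc]
    rw [e1, e2]
    push_cast
    linarith

end Transfer

/-- A linear map that is well conditioned on the sums of `N` signed basis vectors has no vector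
of small `ℓ₁` norm in its kernel. -/
theorem norm_sq_le_sum_abs_sq_of_map_eq_zero {F : Type*} [NormedAddCommGroup F]
    [InnerProductSpace ℝ F] {n N : ℕ} (T : EuclideanSpace ℝ (Fin n) →ₗ[ℝ] F) {κ : ℝ} (hκ : 0 < κ)
    (hN : 1 ≤ N)
    (hlow : ∀ s : Multiset (Fin n × Bool), s.card = N →
      κ / 2 * ‖signedSum s‖ ^ 2 ≤ ‖T (signedSum s)‖ ^ 2)
    (hupp : ∀ s : Multiset (Fin n × Bool), s.card = N →
      ‖T (signedSum s)‖ ^ 2 ≤ 2 * κ * ‖signedSum s‖ ^ 2)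
    (x : EuclideanSpace ℝ (Fin n)) (hx : T x = 0) :
    (N - 1) * ‖x‖ ^ 2 ≤ 4 * (∑ j, |x j|) ^ 2 := by
  have hN' : (1 : ℝ) ≤ N := by exact_mod_cast hN
  set R := ∑ j, |x j| with hR
  rcases eq_or_lt_of_le (Finset.sum_nonneg fun j _ => abs_nonneg (x j) : 0 ≤ R) with h0 | hRpos
  · have hx0 : x = 0 := by
      ext j
      have := (Finset.sum_eq_zero_iff_of_nonneg fun j _ => abs_nonneg (x j)).1 h0.symm j
        (Finset.mem_univ _)
      simpa using this
    rw [hx0]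
    simp only [norm_zero]
    nlinarith [sq_nonneg R]
  let g : Fin n → Fin n × Bool := fun j => (j, decide (0 ≤ x j))
  -- Repetitions are allowed, so `N` copies of one signed basis vector are a test vector; this
  -- controls single columns.
  have hcol : ∀ p : Fin n × Bool, ‖T (signedBasisVector p)‖ ^ 2 ≤ 2 * κ := by
    intro p
    have := hupp (Multiset.replicate N p) (by simp)
    have e : signedSum (Multiset.replicate N p) = (N : ℝ) • signedBasisVector p := by
      simp [signedSum, Nat.cast_smul_eq_nsmul]
    have e1 : ‖signedBasisVector p‖ = 1 := by
      rw [signedBasisVector, PiLp.norm_single]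
      split_ifs <;> simp
    rw [e, map_smul, norm_smul, norm_smul, e1] at this
    simp only [Real.norm_natCast, mul_one, mul_pow] at this
    have hp : (0 : ℝ) < (N : ℝ) ^ 2 := by positivity
    nlinarith
  have hmean : ∑ j, (|x j| / R) • (R • signedBasisVector (g j)) = x := by
    ext i
    have : ∀ j, (|x j| / R) • (R • signedBasisVector (g j)) = EuclideanSpace.single j (x j) := by
      intro j
      rw [smul_smul, div_mul_cancel₀ _ hRpos.ne']
      ext l
      simp only [signedBasisVector, g]
      by_cases hl : l = j
      · subst hl
        by_cases h : 0 ≤ x l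
        · simp [h, abs_of_nonneg]
        · simp [h, abs_of_neg (not_le.1 h)]
      · simp [hl]
    simp only [this]
    simp [Finset.sum_apply]
  -- The parameter `κ / 2` is chosen so that the lower conditioning bound makes the left-hand side
  -- nonnegative.
  obtain ⟨s, hs, hle⟩ := exists_multiset_norm_sq_sub_le T (κ / 2) (fun j => |x j| / R)
    (fun j => by positivity) (by rw [← Finset.sum_div, div_self hRpos.ne']) _ x hmean N 0
  have hsum : (s.map fun j => R • signedBasisVector (g j)).sum = R • signedSum (s.map g) := by
    rw [signedSum, Multiset.map_map, Multiset.smul_sum, Multiset.map_map]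
    rfl
  rw [hsum] at hle
  have hl := hlow (s.map g) (by simpa using hs)
  have hw : ∑ j, |x j| / R * (‖T (R • signedBasisVector (g j))‖ ^ 2 -
      κ / 2 * ‖R • signedBasisVector (g j)‖ ^ 2) ≤ 2 * κ * R ^ 2 := by
    have h1 : ∀ j ∈ Finset.univ, |x j| / R * (‖T (R • signedBasisVector (g j))‖ ^ 2 -
        κ / 2 * ‖R • signedBasisVector (g j)‖ ^ 2) ≤ |x j| / R * (2 * κ * R ^ 2) := by
      intro j _
      refine mul_le_mul_of_nonneg_left ?_ (by positivity)
      rw [map_smul, norm_smul, mul_pow, Real.norm_eq_abs, sq_abs]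
      have := mul_le_mul_of_nonneg_left (hcol (g j)) (sq_nonneg R)
      have h2 : 0 ≤ κ / 2 * ‖R • signedBasisVector (g j)‖ ^ 2 := by positivity
      linarith
    refine (Finset.sum_le_sum h1).trans_eq ?_
    rw [← Finset.sum_mul, ← Finset.sum_div, div_self hRpos.ne', one_mul]
  simp only [zero_add, map_smul, hx, smul_zero, norm_zero, norm_smul, mul_pow, Real.norm_eq_abs,
    sq_abs] at hle hw
  have h3 := mul_le_mul_of_nonneg_left hl (sq_nonneg R)
  have h4 : (N : ℝ) * (κ / 2) * ((N - 1) * ‖x‖ ^ 2) ≤ N * (κ / 2) * (4 * R ^ 2) := by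
    have := mul_le_mul_of_nonneg_left hw (by positivity : (0 : ℝ) ≤ N)
    nlinarith
  exact le_of_mul_le_mul_left h4 (by positivity)

/-! ### From conditioning to the null space property -/

/-- The null space property of order `m` of a family of vectors. -/
def HasNullSpaceProperty {ι E : Type*} [Fintype ι] [DecidableEq ι] [AddCommGroup E] [Module ℝ E]
    (m : ℕ) (v : ι → E) : Prop :=
  ∀ a : ι → ℝ, ∑ j, a j • v j = 0 → ∀ I : Finset ι, I.card < m →
    ∑ j ∈ Iᶜ, |a j| ≤ ∑ j ∈ I, |a j| → a = 0

/-- If at least half of the `ℓ₁` mass `R` of a kernel vector sits on `I`, Cauchy–Schwarz gives `R² ≤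
4 |I| ‖x‖²`. Together with `(N - 1) ‖x‖² ≤ 4 R²` this forces `x = 0`, since `16 |I| < N - 1`. -/
theorem hasNullSpaceProperty_of_signedSum {F : Type*} [NormedAddCommGroup F]
    [InnerProductSpace ℝ F] {n N m : ℕ} (T : EuclideanSpace ℝ (Fin n) →ₗ[ℝ] F) {κ : ℝ}
    (hκ : 0 < κ) (hN : 16 * m < N)
    (hlow : ∀ s : Multiset (Fin n × Bool), s.card = N →
      κ / 2 * ‖signedSum s‖ ^ 2 ≤ ‖T (signedSum s)‖ ^ 2)
    (hupp : ∀ s : Multiset (Fin n × Bool), s.card = N →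
      ‖T (signedSum s)‖ ^ 2 ≤ 2 * κ * ‖signedSum s‖ ^ 2) :
    HasNullSpaceProperty m fun j => T (EuclideanSpace.single j 1) := by
  intro a ha I hI hle
  set x : EuclideanSpace ℝ (Fin n) := WithLp.toLp 2 a with hxa
  have hx : T x = 0 := by
    have : x = ∑ j, a j • EuclideanSpace.single j (1 : ℝ) := by
      ext i
      simp [hxa, Pi.single_apply]
    rw [this, map_sum, ← ha]
    exact Finset.sum_congr rfl fun j _ => map_smul T _ _
  have hle : ∑ j ∈ Iᶜ, |x j| ≤ ∑ j ∈ I, |x j| := hle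
  have h1 := norm_sq_le_sum_abs_sq_of_map_eq_zero T hκ (by omega) hlow hupp x hx
  have h2 : ∑ j, |x j| ≤ 2 * ∑ j ∈ I, |x j| := by
    rw [← Finset.sum_add_sum_compl I]
    linarith
  have h3 : (∑ j ∈ I, |x j|) ^ 2 ≤ I.card * ‖x‖ ^ 2 := by
    refine sq_sum_le_card_mul_sum_sq.trans ?_
    rw [EuclideanSpace.norm_sq_eq]
    refine mul_le_mul_of_nonneg_left ?_ (by positivity)
    simp only [sq_abs, Real.norm_eq_abs]
    exact Finset.sum_le_sum_of_subset_of_nonneg (Finset.subset_univ _) fun _ _ _ => sq_nonneg _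
  have h4 : (∑ j, |x j|) ^ 2 ≤ (2 * ∑ j ∈ I, |x j|) ^ 2 :=
    pow_le_pow_left₀ (Finset.sum_nonneg fun _ _ => abs_nonneg _) h2 2
  have h5 : (I.card : ℝ) + 1 ≤ m := by exact_mod_cast hI
  have h6 : (16 : ℝ) * m + 1 ≤ N := by exact_mod_cast hN
  have h7 : ‖x‖ ^ 2 ≤ 0 := by
    by_contra! hpos
    nlinarith
  have : ‖x‖ = 0 := by nlinarith [norm_nonneg x]
  have hx0 : x = 0 := norm_eq_zero.1 this
  simpa [hxa] using hx0

/-! ### Dual certificates and exposed faces -/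

section Duality

variable {ι E : Type*} [Fintype ι] [NormedAddCommGroup E] [NormedSpace ℝ E]

theorem convex_setOf_sum_abs_le_one (I : Finset ι) :
    Convex ℝ {b : ι → ℝ | (∀ i ∈ I, b i = 0) ∧ ∑ i, |b i| ≤ 1} := by
  intro b hb b' hb' s t hs ht hst
  refine ⟨fun i hi => by simp [hb.1 i hi, hb'.1 i hi], ?_⟩
  calc ∑ i, |(s • b + t • b') i| ≤ ∑ i, (s * |b i| + t * |b' i|) := by
        refine Finset.sum_le_sum fun i _ => ?_
        simp only [Pi.add_apply, Pi.smul_apply, smul_eq_mul]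
        refine (abs_add_le _ _).trans_eq ?_
        rw [abs_mul, abs_mul, abs_of_nonneg hs, abs_of_nonneg ht]
    _ = s * ∑ i, |b i| + t * ∑ i, |b' i| := by
        rw [Finset.sum_add_distrib, Finset.mul_sum, Finset.mul_sum]
    _ ≤ s * 1 + t * 1 := by
        gcongr
        exacts [hb.2, hb'.2]
    _ = 1 := by linarith

theorem isCompact_setOf_sum_abs_le_one (I : Finset ι) :
    IsCompact {b : ι → ℝ | (∀ i ∈ I, b i = 0) ∧ ∑ i, |b i| ≤ 1} := by
  refine (isCompact_Icc (a := (fun _ => -1 : ι → ℝ)) (b := fun _ => 1)).of_isClosed_subset ?_ ?_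
  · refine IsClosed.inter (s₁ := {b : ι → ℝ | ∀ i ∈ I, b i = 0}) ?_
      (isClosed_le (f := fun b : ι → ℝ => ∑ i, |b i|) (by fun_prop) continuous_const)
    simp only [Set.ofPred_forall]
    exact isClosed_biInter fun i _ => isClosed_eq (continuous_apply i) continuous_const
  · intro b hb
    have h : ∀ i, |b i| ≤ 1 := fun i =>
      (Finset.single_le_sum (f := fun i => |b i|) (fun i _ => abs_nonneg (b i))
        (Finset.mem_univ i)).trans hb.2
    exact ⟨fun i => (abs_le.1 (h i)).1, fun i => (abs_le.1 (h i)).2⟩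

/-- The dual certificate: a functional with prescribed signs on a small set of the vectors that is
strictly smaller on the others. -/
theorem HasNullSpaceProperty.exists_functional [DecidableEq ι] [FiniteDimensional ℝ E] {m : ℕ} {v : ι → E}
    (hv : HasNullSpaceProperty m v)
    {I : Finset ι} (hI : I.card < m) (hne : I.Nonempty) {ε : ι → ℝ} (hε : ∀ i ∈ I, |ε i| = 1) :
    ∃ f : E →L[ℝ] ℝ, (∀ i ∈ I, f (v i) = ε i) ∧ ∀ j ∉ I, |f (v j)| < 1 := by
  obtain ⟨i₀, hi₀⟩ := hne
  obtain ⟨p, hp⟩ : ∃ p, p = ε i₀ • v i₀ := ⟨_, rfl⟩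
  set D : Submodule ℝ E := Submodule.span ℝ ((fun i => ε i • v i - p) '' (I : Set ι)) with hD
  set K : Set (ι → ℝ) := {b | (∀ i ∈ I, b i = 0) ∧ ∑ i, |b i| ≤ 1} with hK
  set L : (ι → ℝ) →ₗ[ℝ] E := Fintype.linearCombination ℝ v with hL
  -- The two sets to separate are the image of the `ℓ₁` ball on `Iᶜ` and the affine span of the
  -- points `ε i • v i`. A common point gives a linear relation with mass at least `1` on `I` and at
  -- most `1` on `Iᶜ`, which the null space property excludes.
  have hdisj : Disjoint (L '' K) {x | x - p ∈ D} := by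
    rw [Set.disjoint_left]
    rintro _ ⟨b, hb, rfl⟩ hx
    obtain ⟨c₀, hc₀⟩ :=
      (Submodule.mem_span_image_finset_iff_exists_fun ℝ).1 (show L b - p ∈ D from hx)
    obtain ⟨c, hc⟩ : ∃ c : ι → ℝ, ∑ i ∈ I, c i • (ε i • v i - p) = L b - p := by
      refine ⟨fun i => if h : i ∈ I then c₀ ⟨i, h⟩ else 0, ?_⟩
      rw [← hc₀, ← Finset.sum_coe_sort]
      simp
    -- The coefficient of the base point `i₀` is corrected so that the coefficients form an affine
    -- combination.
    set a : ι → ℝ := fun i => c i + if i = i₀ then 1 - ∑ i ∈ I, c i else 0 with ha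
    have hsum : ∑ i ∈ I, a i = 1 := by
      simp [ha, Finset.sum_add_distrib, hi₀]
    have hval : ∑ i ∈ I, (a i * ε i) • v i = L b := by
      have : ∀ i, (a i * ε i) • v i =
          c i • (ε i • v i) + (if i = i₀ then (1 - ∑ i ∈ I, c i) else 0) • (ε i • v i) := by
        intro i
        rw [mul_smul, ha, add_smul]
      simp only [this, Finset.sum_add_distrib, ite_smul, zero_smul, Finset.sum_ite_eq', hi₀,
        if_true]
      simp only [smul_sub, Finset.sum_sub_distrib, ← Finset.sum_smul] at hc
      rw [sub_eq_iff_eq_add.1 hc.symm, sub_smul, one_smul, ← hp]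
      abel
    set h : ι → ℝ := fun i => if i ∈ I then a i * ε i else -b i with hh
    have hI1 : ∑ i ∈ I, |h i| = ∑ i ∈ I, |a i| :=
      Finset.sum_congr rfl fun i hi => by simp [hh, hi, abs_mul, hε i hi]
    have hI2 : ∑ i ∈ Iᶜ, |h i| = ∑ i ∈ Iᶜ, |b i| :=
      Finset.sum_congr rfl fun i hi => by simp [hh, Finset.mem_compl.1 hi]
    have h1 : 1 ≤ ∑ i ∈ I, |a i| :=
      hsum.symm.le.trans (Finset.sum_le_sum fun i _ => le_abs_self _)
    have h2 : ∑ i ∈ Iᶜ, |b i| ≤ 1 :=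
      (Finset.sum_le_sum_of_subset_of_nonneg (Finset.subset_univ _) fun _ _ _ =>
        abs_nonneg _).trans hb.2
    have h0 : ∑ i, h i • v i = 0 := by
      rw [← Finset.sum_add_sum_compl I]
      have e1 : ∑ i ∈ I, h i • v i = L b := by
        rw [← hval]
        exact Finset.sum_congr rfl fun i hi => by simp [hh, hi]
      have e2 : ∑ i ∈ Iᶜ, h i • v i = -L b := by
        rw [hL, Fintype.linearCombination_apply, ← Finset.sum_add_sum_compl I,
          Finset.sum_eq_zero (s := I) fun i hi => by rw [hb.1 i hi, zero_smul], zero_add,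
          ← Finset.sum_neg_distrib]
        exact Finset.sum_congr rfl fun i hi => by simp [hh, Finset.mem_compl.1 hi]
      rw [e1, e2, add_neg_cancel]
    have := hv h h0 I hI (by rw [hI1, hI2]; exact h2.trans h1)
    rw [this] at hI1
    simp only [Pi.zero_apply, abs_zero, Finset.sum_const_zero] at hI1
    linarith
  have hconvA : Convex ℝ {x | x - p ∈ D} := by
    have := (D.convex).translate_preimage_left (-p)
    simpa [Set.preimage, sub_eq_add_neg] using this
  have hclosedA : IsClosed {x | x - p ∈ D} :=
    (D.closed_of_finiteDimensional).preimage (continuous_id.sub continuous_const)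
  obtain ⟨f, u, w, hfu, huw, hfw⟩ := geometric_hahn_banach_compact_closed
    ((convex_setOf_sum_abs_le_one I).linear_image L)
    ((isCompact_setOf_sum_abs_le_one I).image L.continuous_of_finiteDimensional)
    hconvA hclosedA hdisj
  -- A functional bounded below on an affine subspace is constant on it; its value `f p` is positive
  -- because `0` lies in the compact set, and dividing by it normalizes the functional.
  have hfD : ∀ d ∈ D, f d = 0 := by
    intro d hd
    by_contra hne
    have := hfw (p + ((u - f p) / f d) • d) (by simpa using D.smul_mem _ hd)
    rw [map_add, map_smul, smul_eq_mul, div_mul_cancel₀ _ hne] at this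
    linarith
  have hu0 : 0 < u := by
    have := hfu (L 0) ⟨0, ⟨fun _ _ => rfl, by simp⟩, rfl⟩
    simpa using this
  have hfp : u < f p := huw.trans (hfw p (by simp))
  have hfp0 : 0 < f p := hu0.trans hfp
  refine ⟨(f p)⁻¹ • f, fun i hi => ?_, fun j hj => ?_⟩
  · have h1 := hfD (ε i • v i - p) (Submodule.subset_span ⟨i, hi, rfl⟩)
    rw [map_sub, map_smul, smul_eq_mul, sub_eq_zero] at h1
    have h2 : ε i * ε i = 1 := by
      have := hε i hi
      rw [← abs_mul_abs_self, this, one_mul]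
    have h3 : f (v i) = ε i * f p := by rw [← h1, ← mul_assoc, h2, one_mul]
    simp only [smul_apply, smul_eq_mul]
    rw [h3]
    field_simp
  · have key : ∀ t : ℝ, |t| = 1 → t * f (v j) < f p := by
      intro t ht
      have := hfu (L (Pi.single j t)) ⟨Pi.single j t, ⟨fun i hi => ?_, ?_⟩, rfl⟩
      · rw [hL, Fintype.linearCombination_apply_single, map_smul, smul_eq_mul] at this
        exact this.trans hfp
      · rw [Pi.single_eq_of_ne]
        rintro rfl
        exact hj hi
      · rw [Finset.sum_eq_single j (fun i _ hij => by simp [hij]) (by simp)]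
        simp [ht]
    have k1 := key 1 (by simp)
    have k2 := key (-1) (by simp)
    simp only [smul_apply, smul_eq_mul]
    rw [abs_mul, abs_of_pos (inv_pos.2 hfp0), inv_mul_lt_iff₀ hfp0, mul_one, abs_lt]
    constructor <;> linarith

/-- A functional exposes the face spanned by the vertices that it maximizes. -/
theorem isVertexSetOfFace_of_functional {V S : Set E} (hS : S ⊆ (convexHull ℝ V).extremePoints ℝ)
    (hne : S.Nonempty) (f : E →L[ℝ] ℝ) (hle : ∀ x ∈ V, f x ≤ 1) (heq : ∀ x ∈ V, f x = 1 ↔ x ∈ S) :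
    IsVertexSetOfFace (convexHull ℝ V) S := by
  have hSV : S ⊆ V := hS.trans extremePoints_convexHull_subset
  have hK : ∀ x ∈ convexHull ℝ V, f x ≤ 1 := fun x hx =>
    convexHull_min (s := V) (t := {x | f x ≤ 1}) hle (convex_halfSpace_le f.isLinear 1) hx
  have hexp := ContinuousLinearMap.toExposed.isExposed (l := f) (A := convexHull ℝ V)
  obtain ⟨s, hs⟩ := hne
  have hmem : ∀ x, x ∈ f.toExposed (convexHull ℝ V) ↔ x ∈ convexHull ℝ V ∧ f x = 1 := by
    intro x
    constructor
    · rintro ⟨hx, hmax⟩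
      refine ⟨hx, le_antisymm (hK x hx) ?_⟩
      rw [← (heq s (hSV hs)).2 hs]
      exact hmax s (subset_convexHull ℝ V (hSV hs))
    · rintro ⟨hx, h1⟩
      exact ⟨hx, fun y hy => h1 ▸ hK y hy⟩
  refine ⟨_, hexp, ?_⟩
  rw [hexp.isExtreme.extremePoints_eq]
  ext x
  constructor
  · rintro ⟨hx, hxe⟩
    exact (heq x (extremePoints_convexHull_subset hxe)).1 ((hmem x).1 hx).2
  · intro hx
    exact ⟨(hmem x).2 ⟨subset_convexHull ℝ V (hSV hx), (heq x (hSV hx)).2 hx⟩, hS hx⟩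

theorem isVertexSetOfFace_empty (K : Set E) : IsVertexSetOfFace K ∅ :=
  ⟨∅, isExposed_empty, extremePoints_empty⟩

/-- The face where `f` is maximal is compact and nonempty, so by Krein–Milman it has an extreme
point. That point is extreme in the hull, hence lies in `V`, hence is `x`. -/
theorem mem_extremePoints_of_functional {V : Set E} (hV : V.Finite) {x : E} (hx : x ∈ V)
    (f : E →L[ℝ] ℝ) (hlt : ∀ y ∈ V, y ≠ x → f y < f x) :
    x ∈ (convexHull ℝ V).extremePoints ℝ := by
  have hexp := ContinuousLinearMap.toExposed.isExposed (l := f) (A := convexHull ℝ V)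
  have hK : ∀ y ∈ convexHull ℝ V, f y ≤ f x := fun y hy =>
    convexHull_min (s := V) (t := {y | f y ≤ f x})
      (fun y hy => by
        by_cases h : y = x
        · exact (congrArg f h).le
        · exact (hlt y hy h).le)
      (convex_halfSpace_le f.isLinear _) hy
  have hxK := subset_convexHull ℝ V hx
  obtain ⟨y, hy⟩ := (hexp.isCompact (hV.isCompact_convexHull ℝ)).extremePoints_nonempty ⟨x, hxK, hK⟩
  rw [hexp.isExtreme.extremePoints_eq] at hy
  have hyV := extremePoints_convexHull_subset hy.2
  by_cases h : y = x
  · exact h ▸ hy.2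
  · exact absurd (hy.1.2 x hxK) (not_le.2 (hlt y hyV h))

end Duality

/-! ### The null space property implies neighborliness -/

section Hulls

variable {ι E : Type*} [Fintype ι] [DecidableEq ι] [NormedAddCommGroup E] [NormedSpace ℝ E]
  [FiniteDimensional ℝ E] {m : ℕ} {v : ι → E}

theorem HasNullSpaceProperty.exists_functional_single (hv : HasNullSpaceProperty m v) (hm : 2 ≤ m)
    (i : ι) : ∃ f : E →L[ℝ] ℝ, f (v i) = 1 ∧ ∀ j ≠ i, |f (v j)| < 1 := by
  obtain ⟨f, h1, h2⟩ := hv.exists_functional (I := {i}) (by rw [Finset.card_singleton]; omega) (by simp)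
    (ε := fun _ => 1) (by simp)
  exact ⟨f, h1 i (by simp), fun j hj => h2 j (by simpa using hj)⟩

theorem HasNullSpaceProperty.injective (hv : HasNullSpaceProperty m v) (hm : 2 ≤ m) :
    Function.Injective v := by
  intro i j hij
  by_contra hne
  obtain ⟨f, h1, h2⟩ := hv.exists_functional_single hm i
  have := h2 j (Ne.symm hne)
  rw [← hij, h1, abs_one] at this
  exact lt_irrefl _ this

theorem HasNullSpaceProperty.ne_neg (hv : HasNullSpaceProperty m v) (hm : 2 ≤ m) (i j : ι) :
    v i ≠ -v j := by
  intro hij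
  obtain ⟨f, h1, h2⟩ := hv.exists_functional_single hm i
  have h3 : f (v j) = -1 := by
    rw [hij, map_neg] at h1
    linarith
  by_cases hji : j = i
  · rw [hji, h1] at h3
    norm_num at h3
  · have := h2 j hji
    rw [h3] at this
    norm_num at this

theorem HasNullSpaceProperty.extremePoints_convexHull (hv : HasNullSpaceProperty m v)
    (hm : 2 ≤ m) : (convexHull ℝ (Set.range v)).extremePoints ℝ = Set.range v := by
  refine extremePoints_convexHull_subset.antisymm ?_
  rintro _ ⟨i, rfl⟩
  obtain ⟨f, h1, h2⟩ := hv.exists_functional_single hm i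
  refine mem_extremePoints_of_functional (Set.finite_range v) ⟨i, rfl⟩ f ?_
  rintro _ ⟨j, rfl⟩ hne
  rw [h1]
  exact (abs_lt.1 (h2 j fun h => hne (h ▸ rfl))).2

theorem HasNullSpaceProperty.extremePoints_symm_convexHull (hv : HasNullSpaceProperty m v)
    (hm : 2 ≤ m) : (convexHull ℝ (Set.range v ∪ -Set.range v)).extremePoints ℝ =
      Set.range v ∪ -Set.range v := by
  refine extremePoints_convexHull_subset.antisymm ?_
  have hfin : (Set.range v ∪ -Set.range v).Finite :=
    (Set.finite_range v).union (Set.finite_range v).neg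
  have key : ∀ i, ∃ f : E →L[ℝ] ℝ, f (v i) = 1 ∧
      ∀ j, (v j ≠ v i → f (v j) < 1) ∧ (-1 < f (v j)) := by
    intro i
    obtain ⟨f, h1, h2⟩ := hv.exists_functional_single hm i
    refine ⟨f, h1, fun j => ?_⟩
    by_cases hji : j = i
    · subst hji
      exact ⟨fun h => absurd rfl h, by rw [h1]; norm_num⟩
    · exact ⟨fun _ => (abs_lt.1 (h2 j hji)).2, (abs_lt.1 (h2 j hji)).1⟩
  rintro x (⟨i, rfl⟩ | ⟨i, hi⟩)
  · obtain ⟨f, h1, h2⟩ := key i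
    refine mem_extremePoints_of_functional hfin (Or.inl ⟨i, rfl⟩) f ?_
    rintro y (⟨j, rfl⟩ | ⟨j, hj⟩) hne
    · rw [h1]
      exact (h2 j).1 hne
    · rw [h1, ← neg_neg y, ← hj, map_neg]
      linarith [(h2 j).2]
  · obtain ⟨f, h1, h2⟩ := key i
    obtain rfl : x = -v i := by rw [hi, neg_neg]
    refine mem_extremePoints_of_functional hfin (Or.inr ⟨i, hi⟩) (-f) ?_
    rintro y (⟨j, rfl⟩ | ⟨j, hj⟩) hne
    · simp only [neg_apply, map_neg, h1]
      linarith [(h2 j).2]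
    · obtain rfl : y = -v j := by rw [hj, neg_neg]
      simp only [neg_apply, map_neg, h1, neg_neg]
      exact (h2 j).1 fun h => hne (by rw [h])

theorem HasNullSpaceProperty.isNeighborly (hv : HasNullSpaceProperty m v) :
    IsNeighborly m (convexHull ℝ (Set.range v)) := by
  classical
  intro S hS hcard
  rcases S.eq_empty_or_nonempty with rfl | hne
  · simpa using isVertexSetOfFace_empty _
  -- A nonempty `S` with fewer than `m` elements forces `2 ≤ m`, which makes the vectors distinct,
  -- so that the index set is no larger than `S`.
  have hm : 2 ≤ m := by have := hne.card_pos; omega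
  have hSV : ∀ x ∈ S, ∃ i, v i = x := fun x hx =>
    (extremePoints_convexHull_subset (hS hx) : x ∈ Set.range v)
  have hIcard : (Finset.univ.filter fun i => v i ∈ S).card ≤ S.card :=
    Finset.card_le_card_of_injOn v (fun i hi => by simpa using hi) (hv.injective hm).injOn
  obtain ⟨s, hs⟩ := hne
  obtain ⟨i, hi⟩ := hSV s hs
  obtain ⟨f, h1, h2⟩ := hv.exists_functional (I := Finset.univ.filter fun i => v i ∈ S)
    (hIcard.trans_lt hcard) ⟨i, by simpa [hi] using hs⟩ (ε := fun _ => 1) (by simp)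
  simp only [Finset.mem_filter, Finset.mem_univ, true_and] at h1 h2
  refine isVertexSetOfFace_of_functional hS ⟨s, hs⟩ f ?_ ?_
  · rintro _ ⟨j, rfl⟩
    by_cases hj : v j ∈ S
    · exact (h1 j hj).le
    · exact (abs_lt.1 (h2 j hj)).2.le
  · rintro _ ⟨j, rfl⟩
    refine ⟨fun h => ?_, fun h => h1 j h⟩
    by_contra hj
    exact (abs_lt.1 (h2 j hj)).2.ne h

theorem HasNullSpaceProperty.isSymmNeighborly (hv : HasNullSpaceProperty m v) :
    IsSymmNeighborly m (convexHull ℝ (Set.range v ∪ -Set.range v)) := by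
  classical
  intro S hS hcard hopp
  rcases S.eq_empty_or_nonempty with rfl | hne
  · simpa using isVertexSetOfFace_empty _
  have hm : 2 ≤ m := by have := hne.card_pos; omega
  have hSV : ∀ x ∈ S, ∃ i, v i = x ∨ v i = -x := by
    intro x hx
    rcases extremePoints_convexHull_subset (hS hx) with ⟨i, hi⟩ | ⟨i, hi⟩
    exacts [⟨i, Or.inl hi⟩, ⟨i, Or.inr hi⟩]
  set I := Finset.univ.filter fun i => v i ∈ S ∨ -v i ∈ S with hI
  set ε : ι → ℝ := fun i => if v i ∈ S then 1 else -1 with hε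
  -- Each index is sent to whichever of `±v i` lies in `S`; this is injective because `v` is
  -- injective and no `v i` equals any `-v j`.
  have hIcard : I.card ≤ S.card := by
    refine Finset.card_le_card_of_injOn (fun i => if v i ∈ S then v i else -v i) ?_ ?_
    · intro i hi
      have hi' : v i ∈ S ∨ -v i ∈ S := by simpa [hI] using hi
      by_cases h : v i ∈ S
      · simp [h]
      · simpa [h] using hi'.resolve_left h
    · intro i _ j _ hij
      by_cases h : v i ∈ S <;> by_cases h' : v j ∈ S <;> simp only [h, h', if_true, if_false] at hij
      · exact hv.injective hm hij
      · exact absurd hij (hv.ne_neg hm i j)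
      · exact absurd hij.symm (hv.ne_neg hm j i)
      · exact hv.injective hm (neg_injective hij)
  obtain ⟨s, hs⟩ := hne
  obtain ⟨i, hi⟩ := hSV s hs
  obtain ⟨f, h1, h2⟩ := hv.exists_functional (I := I) (hIcard.trans_lt hcard)
    ⟨i, by rcases hi with hi | hi <;> simp [hI, hi, hs]⟩ (ε := ε)
    (fun i _ => by simp only [hε]; split_ifs <;> simp)
  have hpos : ∀ j, v j ∈ S → f (v j) = 1 := fun j hj => by
    rw [h1 j (by simp [hI, hj])]
    simp [hε, hj]
  have hneg : ∀ j, -v j ∈ S → f (v j) = -1 := fun j hj => by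
    have : v j ∉ S := fun h => hopp _ h hj
    rw [h1 j (by simp [hI, hj])]
    simp [hε, this]
  have hout : ∀ j, v j ∉ S → -v j ∉ S → |f (v j)| < 1 := fun j hj hj' =>
    h2 j (by simp [hI, hj, hj'])
  have hall : ∀ j, |f (v j)| ≤ 1 := fun j => by
    by_cases hj : v j ∈ S
    · rw [hpos j hj, abs_one]
    · by_cases hj' : -v j ∈ S
      · rw [hneg j hj']; simp
      · exact (hout j hj hj').le
  refine isVertexSetOfFace_of_functional hS ⟨s, hs⟩ f ?_ ?_
  · rintro x (⟨j, rfl⟩ | ⟨j, hj⟩)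
    · exact (abs_le.1 (hall j)).2
    · obtain rfl : x = -v j := by rw [hj, neg_neg]
      rw [map_neg]
      linarith [(abs_le.1 (hall j)).1]
  · rintro x (⟨j, rfl⟩ | ⟨j, hj⟩)
    · refine ⟨fun h => ?_, hpos j⟩
      by_contra hj
      by_cases hj' : -v j ∈ S
      · rw [hneg j hj'] at h
        norm_num at h
      · exact (abs_lt.1 (hout j hj hj')).2.ne h
    · obtain rfl : x = -v j := by rw [hj, neg_neg]
      rw [map_neg]
      refine ⟨fun h => ?_, fun h => by rw [hneg j h, neg_neg]⟩
      by_contra hj'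
      by_cases hj'' : v j ∈ S
      · rw [hpos j hj''] at h
        norm_num at h
      · exact (abs_lt.1 (hout j hj'' hj')).1.ne' (by linarith)

end Hulls

theorem HasNullSpaceProperty.mono {ι E : Type*} [Fintype ι] [DecidableEq ι] [AddCommGroup E]
    [Module ℝ E] {m m' : ℕ} {v : ι → E} (hv : HasNullSpaceProperty m' v) (h : m ≤ m') :
    HasNullSpaceProperty m v :=
  fun a ha I hI hle => hv a ha I (hI.trans_le h) hle

theorem HasNullSpaceProperty.hasNeighborlyHulls {k n m : ℕ} {Γ : Matrix (Fin k) (Fin n) ℝ}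
    (hv : HasNullSpaceProperty m (columnVector Γ)) : HasNeighborlyHulls m Γ := by
  refine ⟨hv.isNeighborly, hv.isSymmNeighborly, fun hm => ⟨?_, ?_⟩⟩
  · rw [columnHull, hv.extremePoints_convexHull hm, Set.ncard_range_of_injective (hv.injective hm)]
    simp
  · have hdisj : Disjoint (Set.range (columnVector Γ)) (-Set.range (columnVector Γ)) := by
      rw [Set.disjoint_left]
      rintro _ ⟨i, rfl⟩ ⟨j, hj⟩
      exact hv.ne_neg hm j i hj
    rw [symmColumnHull, hv.extremePoints_symm_convexHull hm,
      Set.ncard_union_eq hdisj (Set.finite_range _) (Set.finite_range _).neg, ← Set.image_neg_eq_neg,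
      Set.ncard_image_of_injective _ neg_injective,
      Set.ncard_range_of_injective (hv.injective hm)]
    simp [two_mul]

/-- For `m ≤ 1` only the empty set has to be a vertex set, and the empty face provides it. -/
theorem hasNeighborlyHulls_of_le_one {k n m : ℕ} (hm : m ≤ 1) (Γ : Matrix (Fin k) (Fin n) ℝ) :
    HasNeighborlyHulls m Γ := by
  have h : ∀ S : Finset (EuclideanSpace ℝ (Fin k)), S.card < m → S = ∅ := fun S hS =>
    Finset.card_eq_zero.1 (by omega)
  refine ⟨fun S _ hS => ?_, fun S _ hS _ => ?_, fun h => by omega⟩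
  all_goals
    rw [h S hS]
    simpa using isVertexSetOfFace_empty _

/-! ### Concentration for a fixed vector -/

theorem exp_le_one_add_add_sq_mul_exp_abs (t : ℝ) :
    Real.exp t ≤ 1 + t + t ^ 2 * Real.exp |t| := by
  have h := Complex.norm_exp_sub_sum_le_norm_mul_exp (t : ℂ) 2
  have e : Complex.exp t - ∑ m ∈ Finset.range 2, (t : ℂ) ^ m / (m.factorial : ℂ) =
      ((Real.exp t - (1 + t) : ℝ) : ℂ) := by
    simp [Finset.sum_range_succ]
  rw [e, Complex.norm_real, Complex.norm_real, Real.norm_eq_abs, Real.norm_eq_abs, sq_abs] at h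
  linarith [le_abs_self (Real.exp t - (1 + t))]

/-- For `|l| ≤ 1 / (4β)` the remainder `(lw)² exp |lw|` is absorbed by the exponential moment: with
`s = w / β`, `s² exp(s / 4) ≤ 4 exp s`. -/
theorem exp_mul_le {w β l : ℝ} (hw : 0 ≤ w) (hβ : 0 < β) (hl : |l| ≤ 1 / (4 * β)) :
    Real.exp (l * w) ≤ 1 + l * w + 4 * l ^ 2 * β ^ 2 * Real.exp (w / β) := by
  refine (exp_le_one_add_add_sq_mul_exp_abs _).trans ?_
  have h1 : |l * w| ≤ w / β / 4 := by
    rw [abs_mul, abs_of_nonneg hw]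
    calc |l| * w ≤ 1 / (4 * β) * w := by gcongr
      _ = w / β / 4 := by field_simp
  obtain ⟨s, hs⟩ : ∃ s, s = w / β := ⟨_, rfl⟩
  have hs0 : 0 ≤ s := by rw [hs]; positivity
  have hw' : w = s * β := by rw [hs]; field_simp
  rw [← hs] at h1 ⊢
  have h2 : s ^ 2 ≤ 4 * Real.exp (3 * s / 4) := by
    have := Real.quadratic_le_exp_of_nonneg (x := 3 * s / 4) (by positivity)
    nlinarith
  have h3 : s ^ 2 * Real.exp (s / 4) ≤ 4 * Real.exp s := by
    have : Real.exp s = Real.exp (3 * s / 4) * Real.exp (s / 4) := by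
      rw [← Real.exp_add]; ring_nf
    rw [this, ← mul_assoc]
    gcongr
  have h4 : (l * w) ^ 2 * Real.exp |l * w| ≤ l ^ 2 * β ^ 2 * (4 * Real.exp s) := by
    calc (l * w) ^ 2 * Real.exp |l * w| ≤ (l * w) ^ 2 * Real.exp (s / 4) := by gcongr
      _ = l ^ 2 * β ^ 2 * (s ^ 2 * Real.exp (s / 4)) := by rw [hw']; ring
      _ ≤ _ := by gcongr
  linarith

section Chernoff

variable {Ω : Type*} [MeasurableSpace Ω]

theorem integrable_exp_mul_and_mgf_le {μ : Measure Ω} [IsProbabilityMeasure μ] {W : Ω → ℝ}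
    (hW0 : ∀ ω, 0 ≤ W ω) (hWm : AEMeasurable W μ) (hW1 : ∫ ω, W ω ∂μ = 1) {β : ℝ} (hβ : 0 < β)
    (hexp : ∫⁻ ω, ENNReal.ofReal (Real.exp (W ω / β)) ∂μ ≤ 2) {l : ℝ} (hl : |l| ≤ 1 / (4 * β)) :
    Integrable (fun ω => Real.exp (l * W ω)) μ ∧
      mgf W μ l ≤ Real.exp (l + 8 * l ^ 2 * β ^ 2) := by
  have hWint : Integrable W μ := by
    -- The integral of a non-integrable function is `0` by convention, so mean one already yields
    -- integrability.
    by_contra h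
    rw [integral_undef h] at hW1
    exact zero_ne_one hW1
  have hm : AEStronglyMeasurable (fun ω => Real.exp (W ω / β)) μ := by fun_prop
  have hEint : Integrable (fun ω => Real.exp (W ω / β)) μ := by
    refine ⟨hm, ?_⟩
    rw [hasFiniteIntegral_iff_ofReal (Filter.Eventually.of_forall fun _ => (Real.exp_pos _).le)]
    exact hexp.trans_lt (by simp)
  have hE2 : ∫ ω, Real.exp (W ω / β) ∂μ ≤ 2 := by
    rw [integral_eq_lintegral_of_nonneg_ae
      (Filter.Eventually.of_forall fun _ => (Real.exp_pos _).le) hm]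
    exact ENNReal.toReal_le_of_le_ofReal (by norm_num) (by simpa using hexp)
  have hbd : Integrable
      (fun ω => 1 + l * W ω + 4 * l ^ 2 * β ^ 2 * Real.exp (W ω / β)) μ :=
    ((integrable_const _).add (hWint.const_mul _)).add (hEint.const_mul _)
  have hint : Integrable (fun ω => Real.exp (l * W ω)) μ := by
    refine hbd.mono' (by fun_prop) (Filter.Eventually.of_forall fun ω => ?_)
    rw [Real.norm_eq_abs, abs_of_pos (Real.exp_pos _)]
    exact exp_mul_le (hW0 ω) hβ hl
  refine ⟨hint, ?_⟩
  calc mgf W μ l ≤ ∫ ω, (1 + l * W ω + 4 * l ^ 2 * β ^ 2 * Real.exp (W ω / β)) ∂μ :=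
        integral_mono hint hbd fun ω => exp_mul_le (hW0 ω) hβ hl
    _ = 1 + l * 1 + 4 * l ^ 2 * β ^ 2 * ∫ ω, Real.exp (W ω / β) ∂μ := by
        rw [integral_add (f := fun ω => 1 + l * W ω)
            ((integrable_const _).add (hWint.const_mul _)) (hEint.const_mul _),
          integral_add (integrable_const _) (hWint.const_mul _), integral_const_mul,
          integral_const_mul, hW1]
        simp
    _ ≤ 1 + l * 1 + 4 * l ^ 2 * β ^ 2 * 2 := by gcongr
    _ = (l + 8 * l ^ 2 * β ^ 2) + 1 := by ring
    _ ≤ _ := Real.add_one_le_exp _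

/-- Two-sided Bernstein inequality for sums of independent nonnegative variables of mean one. -/
theorem measureReal_sum_lt_or_lt_le {P : Measure Ω} [IsProbabilityMeasure P] {k : ℕ}
    {W : Fin k → Ω → ℝ} (hindep : iIndepFun W P)
    (hW0 : ∀ i ω, 0 ≤ W i ω) (hWm : ∀ i, AEMeasurable (W i) P) (hW1 : ∀ i, ∫ ω, W i ω ∂P = 1)
    {β : ℝ} (hβ : 1 ≤ β)
    (hexp : ∀ i, ∫⁻ ω, ENNReal.ofReal (Real.exp (W i ω / β)) ∂P ≤ 2) :
    P.real {ω | ∑ i, W i ω < k / 2 ∨ 2 * k < ∑ i, W i ω} ≤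
      2 * Real.exp (-(k / (128 * β ^ 2))) := by
  have hβ0 : 0 < β := by linarith
  -- This makes the quadratic term `8 l² β²` equal to `l / 4`. The exponents are then `-l k / 4` for
  -- the lower tail and `-3 l k / 4` for the upper one.
  set l := 1 / (32 * β ^ 2) with hl
  have hl0 : 0 < l := by positivity
  have hlb : l ≤ 1 / (4 * β) := one_div_le_one_div_of_le (by positivity) (by nlinarith)
  have hlβ : l * β ^ 2 = 1 / 32 := by rw [hl]; field_simp
  have hsum : (∑ i, W i) = fun ω => ∑ i, W i ω := by ext ω; simp
  have hmgf : ∀ t, |t| ≤ 1 / (4 * β) → Integrable (fun ω => Real.exp (t * (∑ i, W i) ω)) P ∧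
      mgf (∑ i, W i) P t ≤ Real.exp (k * (t + 8 * t ^ 2 * β ^ 2)) := by
    intro t ht
    have h := fun i => integrable_exp_mul_and_mgf_le (hW0 i) (hWm i) (hW1 i) hβ0 (hexp i) ht
    constructor
    -- Without integrability the `mgf` of the sum would be `0` by convention, but it is a product of
    -- positive factors.
    · by_contra hnot
      have h0 := mgf_undef hnot
      rw [hindep.mgf_sum₀ hWm] at h0
      exact (Finset.prod_pos fun i _ => mgf_pos (h i).1).ne' h0
    · rw [hindep.mgf_sum₀ hWm]
      refine (Finset.prod_le_prod (fun i _ => mgf_nonneg) fun i _ => (h i).2).trans_eq ?_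
      rw [Finset.prod_const, Finset.card_univ, Fintype.card_fin, ← Real.exp_nat_mul]
  have hk : (0 : ℝ) ≤ k := Nat.cast_nonneg k
  have hkl : l / 4 * k = k / (128 * β ^ 2) := by rw [hl]; field_simp; ring
  have e1 : P.real {ω | (∑ i, W i) ω ≤ k / 2} ≤ Real.exp (-(k / (128 * β ^ 2))) := by
    obtain ⟨h1, h2⟩ := hmgf (-l) (by rwa [abs_neg, abs_of_pos hl0])
    refine (measure_le_le_exp_mul_mgf _ (by linarith) h1).trans ?_
    refine (mul_le_mul_of_nonneg_left h2 (Real.exp_pos _).le).trans ?_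
    rw [← Real.exp_add, Real.exp_le_exp, ← hkl]
    have : 8 * (-l) ^ 2 * β ^ 2 = l / 4 := by
      have : 8 * (-l) ^ 2 * β ^ 2 = 8 * l * (l * β ^ 2) := by ring
      rw [this, hlβ]; ring
    rw [this]
    linarith
  have e2 : P.real {ω | 2 * k ≤ (∑ i, W i) ω} ≤ Real.exp (-(k / (128 * β ^ 2))) := by
    obtain ⟨h1, h2⟩ := hmgf l (by rwa [abs_of_pos hl0])
    refine (measure_ge_le_exp_mul_mgf _ hl0.le h1).trans ?_
    refine (mul_le_mul_of_nonneg_left h2 (Real.exp_pos _).le).trans ?_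
    rw [← Real.exp_add, Real.exp_le_exp, ← hkl]
    have : 8 * l ^ 2 * β ^ 2 = l / 4 := by
      have : 8 * l ^ 2 * β ^ 2 = 8 * l * (l * β ^ 2) := by ring
      rw [this, hlβ]; ring
    rw [this]
    nlinarith [mul_nonneg hk hl0.le]
  rw [hsum] at e1 e2
  calc P.real {ω | ∑ i, W i ω < k / 2 ∨ 2 * k < ∑ i, W i ω}
      ≤ P.real ({ω | ∑ i, W i ω ≤ k / 2} ∪ {ω | 2 * k ≤ ∑ i, W i ω}) :=
        measureReal_mono (by rintro ω (h | h); exacts [Or.inl h.le, Or.inr h.le])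
    _ ≤ _ := measureReal_union_le _ _
    _ ≤ _ := by linarith

end Chernoff

theorem IsPsiTwoMeasure.lintegral_exp_le {n : ℕ} {μ : Measure (EuclideanSpace ℝ (Fin n))} {α : ℝ}
    (h : IsPsiTwoMeasure μ α) (hα : 1 ≤ α) {z : EuclideanSpace ℝ (Fin n)} (hz : z ≠ 0) :
    ∫⁻ x, ENNReal.ofReal (Real.exp ((inner ℝ x z) ^ 2 / ‖z‖ ^ 2 / (4 * α ^ 2))) ∂μ ≤ 2 := by
  have hz' : 0 < ‖z‖ := norm_pos_iff.2 hz
  -- The infimum is not assumed to be attained; doubling `α` gives strict inequality, hence an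
  -- admissible `u`. This is the source of the factor `4 α²`.
  have hlt : psiTwoNorm (fun x => inner ℝ x z) μ < ENNReal.ofReal (2 * α * ‖z‖) := by
    refine (h z).trans_lt ?_
    rw [ENNReal.ofReal_lt_ofReal_iff (by positivity)]
    nlinarith [mul_pos (by linarith : 0 < α) hz']
  simp only [psiTwoNorm, iInf_lt_iff] at hlt
  obtain ⟨u, hu, hle, hlt⟩ := hlt
  rw [ENNReal.ofReal_lt_ofReal_iff (by positivity)] at hlt
  refine le_trans (lintegral_mono fun x => ENNReal.ofReal_le_ofReal (Real.exp_le_exp.2 ?_)) hle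
  rw [div_div]
  have : u ^ 2 ≤ ‖z‖ ^ 2 * (4 * α ^ 2) := by nlinarith
  gcongr

/-- Concentration of `|Γ z|²` for a fixed vector `z`. -/
theorem measureReal_sum_inner_sq_le {n k : ℕ} {μ : Measure (EuclideanSpace ℝ (Fin n))} {α : ℝ}
    (hα : 1 ≤ α) (hiso : IsIsotropicMeasure μ) (hpsi : IsPsiTwoMeasure μ α)
    {Ω : Type*} [MeasurableSpace Ω] {P : Measure Ω} [IsProbabilityMeasure P]
    {X : Fin k → Ω → EuclideanSpace ℝ (Fin n)} (hindep : iIndepFun X P)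
    (hlaw : ∀ i, HasLaw (X i) μ P) (z : EuclideanSpace ℝ (Fin n)) :
    P.real {ω | ∑ i, inner ℝ (X i ω) z ^ 2 < k / 2 * ‖z‖ ^ 2 ∨
        2 * k * ‖z‖ ^ 2 < ∑ i, inner ℝ (X i ω) z ^ 2} ≤
      2 * Real.exp (-(k / (2048 * α ^ 4))) := by
  rcases eq_or_ne z 0 with rfl | hz
  · simp
    positivity
  have hz' : 0 < ‖z‖ ^ 2 := by have := norm_pos_iff.2 hz; positivity
  set g : EuclideanSpace ℝ (Fin n) → ℝ := fun x => inner ℝ x z ^ 2 / ‖z‖ ^ 2 with hg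
  have hgm : Measurable g := by fun_prop
  have hXm : ∀ i, AEMeasurable (X i) P := fun i => (hlaw i).aemeasurable
  have key := measureReal_sum_lt_or_lt_le (P := P) (W := fun i ω => g (X i ω))
    (hindep.comp (fun _ => g) fun _ => hgm)
    (fun i ω => by positivity) (fun i => hgm.comp_aemeasurable (hXm i))
    (fun i => by
      rw [← integral_map (hXm i) hgm.aestronglyMeasurable, (hlaw i).map_eq, hg,
        integral_div, hiso z, div_self hz'.ne'])
    (β := 4 * α ^ 2) (by nlinarith)
    (fun i => by
      rw [← lintegral_map' (f := fun x => ENNReal.ofReal (Real.exp (g x / (4 * α ^ 2))))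
        (by fun_prop) (hXm i), (hlaw i).map_eq]
      exact hpsi.lintegral_exp_le hα hz)
  have e : 128 * (4 * α ^ 2) ^ 2 = 2048 * α ^ 4 := by ring
  rw [e] at key
  refine le_trans (le_of_eq ?_) key
  congr 1
  ext ω
  simp only [hg, ← Finset.sum_div, Set.mem_ofPred_eq, div_lt_iff₀ hz', lt_div_iff₀ hz']

/-! ### The uniform measure on the sign cube -/

section SignCube

variable (n : ℕ)

/-- The sign vectors as a finite set of functions. -/
noncomputable def signFunctions : Finset (Fin n → ℝ) :=
  Fintype.piFinset fun _ => {-1, 1}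

theorem card_signFunctions : (signFunctions n).card = 2 ^ n := by
  have : ({-1, 1} : Finset ℝ).card = 2 := Finset.card_pair (by norm_num)
  simp [signFunctions, this]

/-- The vertices of the cube. -/
noncomputable def signCube : Finset (EuclideanSpace ℝ (Fin n)) :=
  (signFunctions n).map (WithLp.equiv 2 (Fin n → ℝ)).symm.toEmbedding

theorem coe_signCube : (signCube n : Set (EuclideanSpace ℝ (Fin n))) =
    {x | ∀ j, x j = -1 ∨ x j = 1} := by
  ext x
  simp only [signCube, signFunctions, Finset.coe_map, Set.mem_image, Finset.mem_coe,
    Fintype.mem_piFinset, Finset.mem_insert, Finset.mem_singleton, Set.mem_ofPred_eq]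
  constructor
  · rintro ⟨a, ha, rfl⟩
    exact ha
  · intro hx
    exact ⟨x, hx, rfl⟩

theorem signCubeMeasure_eq : signCubeMeasure n =
    ((2 : ℝ≥0∞) ^ n)⁻¹ • Measure.count.restrict (signCube n : Set (EuclideanSpace ℝ (Fin n))) := by
  rw [signCubeMeasure, ← coe_signCube, uniformOn, ProbabilityTheory.cond, Measure.count_apply_finset, signCube,
    Finset.card_map, card_signFunctions]
  simp

theorem isProbabilityMeasure_signCubeMeasure : IsProbabilityMeasure (signCubeMeasure n) := by
  rw [signCubeMeasure, ← coe_signCube]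
  refine isProbabilityMeasure_uniformOn (Finset.finite_toSet _) ?_
  rw [Finset.coe_nonempty, ← Finset.card_pos, signCube, Finset.card_map, card_signFunctions]
  positivity

variable {n}

theorem lintegral_signCubeMeasure (f : EuclideanSpace ℝ (Fin n) → ℝ≥0∞) :
    ∫⁻ x, f x ∂signCubeMeasure n =
      ((2 : ℝ≥0∞) ^ n)⁻¹ * ∑ σ ∈ signFunctions n, f (WithLp.toLp 2 σ) := by
  rw [signCubeMeasure_eq, lintegral_smul_measure, lintegral_finset, signCube, Finset.sum_map]
  simp

theorem integral_signCubeMeasure (f : EuclideanSpace ℝ (Fin n) → ℝ) :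
    ∫ x, f x ∂signCubeMeasure n =
      ((2 : ℝ) ^ n)⁻¹ * ∑ σ ∈ signFunctions n, f (WithLp.toLp 2 σ) := by
  rw [signCubeMeasure_eq, integral_smul_measure, setIntegral_finset]
  · rw [signCube, Finset.sum_map]
    simp
  · have : IsFiniteMeasure (Measure.count.restrict (signCube n : Set (EuclideanSpace ℝ (Fin n)))) :=
      ⟨by simp [Measure.count_apply_finset]⟩
    have h := IntegrableOn.finset (s := signCube n) (f := f)
      (μ := Measure.count.restrict (signCube n : Set (EuclideanSpace ℝ (Fin n))))
    rwa [IntegrableOn, Measure.restrict_restrict (Finset.measurableSet _), Set.inter_self] at h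

theorem sum_signFunctions_prod (f : Fin n → ℝ → ℝ) :
    ∑ σ ∈ signFunctions n, ∏ i, f i (σ i) = ∏ i, (f i (-1) + f i 1) := by
  rw [signFunctions, ← Finset.prod_univ_sum]
  exact Finset.prod_congr rfl fun i _ => Finset.sum_pair (by norm_num)

theorem sum_signFunctions_mul (i j : Fin n) :
    ∑ σ ∈ signFunctions n, σ i * σ j = if i = j then 2 ^ n else 0 := by
  have h := sum_signFunctions_prod (n := n) fun l x =>
    (if l = i then x else 1) * (if l = j then x else 1)
  simp only [Finset.prod_mul_distrib, Finset.prod_ite_eq', Finset.mem_univ, if_true] at h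
  rw [h]
  split_ifs with hij
  · subst hij
    rw [Finset.prod_congr rfl (g := fun _ => (2 : ℝ)) fun l _ => by split_ifs <;> norm_num]
    simp
  · exact Finset.prod_eq_zero (Finset.mem_univ i) (by simp [hij])

theorem isIsotropicMeasure_signCubeMeasure : IsIsotropicMeasure (signCubeMeasure n) := by
  intro y
  rw [integral_signCubeMeasure, EuclideanSpace.norm_sq_eq]
  have h : ∀ σ : Fin n → ℝ, (inner ℝ (WithLp.toLp 2 σ) y) ^ 2 =
      ∑ i, ∑ j, y i * y j * (σ i * σ j) := by
    intro σ
    simp only [PiLp.inner_apply, sq, Finset.sum_mul_sum]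
    refine Finset.sum_congr rfl fun i _ => Finset.sum_congr rfl fun j _ => ?_
    simp
    ring
  simp only [h]
  rw [Finset.sum_comm]
  have h2 : ∀ i, ∑ σ ∈ signFunctions n, ∑ j, y i * y j * (σ i * σ j) = 2 ^ n * y i ^ 2 := by
    intro i
    rw [Finset.sum_comm]
    simp only [← Finset.mul_sum, sum_signFunctions_mul]
    simp
    ring
  simp only [h2, ← Finset.mul_sum, Real.norm_eq_abs, sq_abs]
  rw [inv_mul_cancel_left₀ (by positivity)]

theorem integrable_exp_neg_sq_add (s : ℝ) :
    Integrable fun g : ℝ => Real.exp (-g ^ 2 + 2 * s * g) := by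
  have h := ((integrable_exp_neg_mul_sq one_pos).comp_sub_right s).const_mul (Real.exp (s ^ 2))
  refine h.congr (Filter.Eventually.of_forall fun g => ?_)
  simp only [← Real.exp_add]
  ring_nf

theorem integral_exp_neg_sq_add (s : ℝ) :
    ∫ g : ℝ, Real.exp (-g ^ 2 + 2 * s * g) = Real.exp (s ^ 2) * √Real.pi := by
  have h : ∀ g : ℝ, Real.exp (-g ^ 2 + 2 * s * g) =
      Real.exp (s ^ 2) * Real.exp (-1 * (g - s) ^ 2) := fun g => by
    rw [← Real.exp_add]
    ring_nf
  simp only [h]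
  rw [integral_const_mul, integral_sub_right_eq_self fun g : ℝ => Real.exp (-1 * g ^ 2),
    integral_gaussian, div_one]

/-- Exponential integrability of the square of a Rademacher sum, by Gaussian linearization. -/
theorem sum_signFunctions_exp_sq_le (a : Fin n → ℝ) (ha : ∑ i, a i ^ 2 ≤ 1 / 4) :
    ∑ σ ∈ signFunctions n, Real.exp ((∑ i, σ i * a i) ^ 2) ≤ 2 ^ n * √2 := by
  have hpi : 0 < √Real.pi := Real.sqrt_pos.2 Real.pi_pos
  refine le_of_mul_le_mul_right ?_ hpi
  calc (∑ σ ∈ signFunctions n, Real.exp ((∑ i, σ i * a i) ^ 2)) * √Real.pi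
      = ∫ g : ℝ, ∑ σ ∈ signFunctions n, Real.exp (-g ^ 2 + 2 * (∑ i, σ i * a i) * g) := by
        rw [integral_finsetSum _ fun σ _ => integrable_exp_neg_sq_add _, Finset.sum_mul]
        simp only [integral_exp_neg_sq_add]
    _ ≤ ∫ g : ℝ, 2 ^ n * Real.exp (-(1 / 2) * g ^ 2) := by
        refine integral_mono (integrable_finsetSum _ fun σ _ => integrable_exp_neg_sq_add _)
          ((integrable_exp_neg_mul_sq (by norm_num)).const_mul _) fun g => ?_
        have h1 : ∀ σ : Fin n → ℝ, Real.exp (-g ^ 2 + 2 * (∑ i, σ i * a i) * g) =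
            Real.exp (-g ^ 2) * ∏ i, Real.exp (σ i * (2 * a i * g)) := fun σ => by
          rw [← Real.exp_sum, ← Real.exp_add, Finset.mul_sum, Finset.sum_mul]
          congr 2
          exact Finset.sum_congr rfl fun i _ => by ring
        simp only [h1, ← Finset.mul_sum]
        rw [sum_signFunctions_prod fun i x => Real.exp (x * (2 * a i * g))]
        -- Since `cosh t ≤ exp(t² / 2)`, the product contributes `exp(2 g² ∑ a i ²)`. The assumption
        -- `∑ a i ² ≤ 1 / 4` lets this use up only half of the Gaussian weight `exp(-g²)`.
        have h2 : ∏ i, (Real.exp (-1 * (2 * a i * g)) + Real.exp (1 * (2 * a i * g))) ≤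
            ∏ i, (2 * Real.exp ((2 * a i * g) ^ 2 / 2)) := by
          refine Finset.prod_le_prod (fun i _ => by positivity) fun i _ => ?_
          have := Real.cosh_le_exp_half_sq (2 * a i * g)
          rw [Real.cosh_eq] at this
          rw [neg_one_mul, one_mul]
          linarith
        calc Real.exp (-g ^ 2) *
              ∏ i, (Real.exp (-1 * (2 * a i * g)) + Real.exp (1 * (2 * a i * g)))
            ≤ Real.exp (-g ^ 2) * ∏ i, (2 * Real.exp ((2 * a i * g) ^ 2 / 2)) := by gcongr
          _ = 2 ^ n * Real.exp (-g ^ 2 + 2 * g ^ 2 * ∑ i, a i ^ 2) := by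
            rw [Finset.prod_mul_distrib, ← Real.exp_sum, Real.exp_add, Finset.mul_sum]
            simp only [Finset.prod_const, Finset.card_univ, Fintype.card_fin]
            rw [mul_left_comm]
            congr 4
            ext i
            ring
          _ ≤ 2 ^ n * Real.exp (-(1 / 2) * g ^ 2) := by
            gcongr
            nlinarith [sq_nonneg g]
    _ = 2 ^ n * √2 * √Real.pi := by
        rw [integral_const_mul, integral_gaussian, mul_assoc, ← Real.sqrt_mul (by norm_num)]
        congr 2
        ring

theorem isPsiTwoMeasure_signCubeMeasure : IsPsiTwoMeasure (signCubeMeasure n) 2 := by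
  intro y
  have hbound : ∀ u : ℝ, 0 < u → 2 * ‖y‖ ≤ u →
      psiTwoNorm (fun x => inner ℝ x y) (signCubeMeasure n) ≤ ENNReal.ofReal u := by
    intro u hu hyu
    refine iInf_le_of_le u (iInf_le_of_le hu (iInf_le_of_le ?_ le_rfl))
    have ha : ∑ i, (y i / u) ^ 2 ≤ 1 / 4 := by
      simp only [div_pow]
      rw [← Finset.sum_div, div_le_iff₀ (by positivity)]
      have : ‖y‖ ^ 2 = ∑ i, y i ^ 2 := by simp [EuclideanSpace.norm_sq_eq]
      rw [← this]
      nlinarith [norm_nonneg y]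
    have h := sum_signFunctions_exp_sq_le _ ha
    have e : ∀ σ : Fin n → ℝ, (inner ℝ (WithLp.toLp 2 σ) y) ^ 2 / u ^ 2 =
        (∑ i, σ i * (y i / u)) ^ 2 := by
      intro σ
      rw [← div_pow, PiLp.inner_apply, Finset.sum_div]
      congr 1
      refine Finset.sum_congr rfl fun i _ => ?_
      simp
      ring
    rw [lintegral_signCubeMeasure]
    simp only [e]
    rw [← ENNReal.ofReal_sum_of_nonneg fun _ _ => (Real.exp_pos _).le]
    have h2 : √2 ≤ 2 := by
      rw [Real.sqrt_le_left (by norm_num)]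
      norm_num
    calc ((2 : ℝ≥0∞) ^ n)⁻¹ *
          ENNReal.ofReal (∑ σ ∈ signFunctions n, Real.exp ((∑ i, σ i * (y i / u)) ^ 2))
        ≤ ((2 : ℝ≥0∞) ^ n)⁻¹ * ENNReal.ofReal (2 ^ n * 2) := by
          gcongr
          exact h.trans (by gcongr)
      _ = 2 := by
          rw [ENNReal.ofReal_mul (by positivity), ENNReal.ofReal_pow (by norm_num),
            ENNReal.ofReal_ofNat, ← mul_assoc, ENNReal.inv_mul_cancel (by simp) (by simp), one_mul]
  rcases eq_or_ne y 0 with rfl | hy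
  -- For `y = 0` the value `u = 2 ‖y‖` is not positive, so arbitrarily small `u` are used instead.
  · refine ENNReal.le_of_forall_pos_le_add fun ε hε _ => ?_
    refine (hbound ε hε (by simp)).trans ?_
    simp
  · have := norm_pos_iff.2 hy
    exact hbound _ (by positivity) le_rfl

end SignCube

/-! ### Counting the test vectors -/

/-- The count is `C(2n + N - 1, N) ≤ C(3n, N) ≤ (3n)^N / N!`, and `N^N / N! ≤ exp N`. -/
theorem card_sym_le {n N : ℕ} (hN : 1 ≤ N) (hNn : N ≤ n) :
    (Fintype.card (Sym (Fin n × Bool) N) : ℝ) ≤ (3 * n * Real.exp 1 / N) ^ N := by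
  have hN0 : (0 : ℝ) < N := by exact_mod_cast hN
  rw [Sym.card_sym_eq_multichoose, Nat.multichoose_eq]
  have h1 : ((Fintype.card (Fin n × Bool) + N - 1).choose N : ℝ) ≤
      ((3 * n : ℕ) : ℝ) ^ N / N.factorial := by
    refine le_trans ?_ (Nat.choose_le_pow_div N (3 * n))
    have : Fintype.card (Fin n × Bool) + N - 1 ≤ 3 * n := by simp; omega
    exact_mod_cast Nat.choose_le_choose N this
  have h2 := Real.pow_div_factorial_le_exp (x := (N : ℝ)) hN0.le N
  have h3 : (0 : ℝ) < N.factorial := by exact_mod_cast N.factorial_pos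
  refine h1.trans ?_
  rw [div_le_iff₀ h3] at h2
  rw [div_pow, div_le_div_iff₀ h3 (by positivity), mul_pow, ← Real.exp_nat_mul, mul_one]
  push_cast
  calc (3 * (n : ℝ)) ^ N * (N : ℝ) ^ N ≤ (3 * (n : ℝ)) ^ N * (Real.exp N * N.factorial) := by gcongr
    _ = _ := by ring

/-- The price of the union bound, including the factor `2` from the two tails, is half of the
exponent `K / 2048` available for one vector, where `K = k / α⁴` in the application. -/
theorem two_mul_card_sym_le {n : ℕ} {K L : ℝ} (hK : 0 < K) (hKn : K ≤ n)
    (hL : L = Real.log (1048576 * n / K)) (h2 : 2 ≤ 1 / 294912 * K / L) :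
    2 * (Fintype.card (Sym (Fin n × Bool) (18 * ⌊1 / 294912 * K / L⌋₊)) : ℝ) ≤
      Real.exp (K / 4096) := by
  have hn : (0 : ℝ) < n := hK.trans_le hKn
  have hnK : 1 ≤ n / K := (one_le_div hK).2 hKn
  have he := Real.exp_one_lt_d9
  have hexpL : Real.exp L = 1048576 * (n / K) := by
    rw [hL, Real.exp_log (by positivity), mul_div_assoc]
  have hL1 : 1 ≤ L := by
    rw [← Real.exp_le_exp, hexpL]
    linarith
  have hL0 : 0 < L := by linarith
  set M := ⌊1 / 294912 * K / L⌋₊ with hM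
  have hMle : (M : ℝ) ≤ 1 / 294912 * K / L := Nat.floor_le (by positivity)
  have hMlt : 1 / 294912 * K / L < M + 1 := Nat.lt_floor_add_one _
  have hM1' : (1 : ℝ) ≤ M := by
    have : 2 ≤ M := Nat.le_floor (by exact_mod_cast h2)
    exact_mod_cast (by omega : 1 ≤ M)
  have hM1 : 1 ≤ M := by exact_mod_cast hM1'
  have hML : (M : ℝ) * L ≤ 1 / 294912 * K := (le_div_iff₀ hL0).1 hMle
  have hKM : 1 / 294912 * K ≤ 2 * M * L := by
    rw [← div_le_iff₀ hL0]
    linarith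
  have hNn : 18 * M ≤ n := by
    have : (18 : ℝ) * M ≤ n := by nlinarith
    exact_mod_cast this
  have hcard := card_sym_le (by omega) hNn
  -- As `M` is at least of order `K / L`, the base is at most `exp L * L`, and the extra `L` costs
  -- at most another `exp L`.
  have hbase : 3 * n * Real.exp 1 / ((18 * M : ℕ) : ℝ) ≤ Real.exp (2 * L) := by
    have hLe : L ≤ Real.exp L := by linarith [Real.add_one_le_exp L]
    push_cast
    rw [div_le_iff₀ (by positivity)]
    have e2 : Real.exp (2 * L) = Real.exp L * Real.exp L := by rw [← Real.exp_add]; ring_nf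
    rw [e2]
    calc 3 * n * Real.exp 1 ≤ 3 * n * 3 := by gcongr; linarith
      _ = 9 * (n / K) * K := by field_simp; norm_num
      _ ≤ 9 * (n / K) * (294912 * (2 * M * L)) := by
          gcongr
          linarith
      _ ≤ 18 * 1048576 * (n / K) * (M * L) := by
          have : 0 ≤ n / K * (M * L) := by positivity
          linarith
      _ = Real.exp L * L * (18 * M) := by rw [hexpL]; ring
      _ ≤ Real.exp L * Real.exp L * (18 * M) := by gcongr
  -- The exponent is `18 M * 2 L = 36 M L`, and `294912 = 36 * 8192`.
  have hpow : (3 * n * Real.exp 1 / ((18 * M : ℕ) : ℝ)) ^ (18 * M) ≤ Real.exp (K / 8192) := by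
    refine (pow_le_pow_left₀ (by positivity) hbase _).trans ?_
    rw [← Real.exp_nat_mul, Real.exp_le_exp]
    push_cast
    linarith
  have htwo : 2 ≤ Real.exp (K / 8192) := by
    have : 1 ≤ K / 8192 := by nlinarith
    linarith [Real.add_one_le_exp (K / 8192)]
  calc 2 * (Fintype.card (Sym (Fin n × Bool) (18 * M)) : ℝ)
      ≤ Real.exp (K / 8192) * Real.exp (K / 8192) := by
        gcongr
        exact hcard.trans hpow
    _ = Real.exp (K / 4096) := by rw [← Real.exp_add]; ring_nf

/-! ### Union bound and conclusion -/

theorem norm_sq_toEuclideanLin_rowMatrix {k n : ℕ} (x : Fin k → EuclideanSpace ℝ (Fin n))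
    (z : EuclideanSpace ℝ (Fin n)) :
    ‖(rowMatrix x).toEuclideanLin z‖ ^ 2 = ∑ i, inner ℝ (x i) z ^ 2 := by
  rw [EuclideanSpace.norm_sq_eq]
  refine Finset.sum_congr rfl fun i _ => ?_
  rw [Real.norm_eq_abs, sq_abs]
  congr 1
  simp [Matrix.mulVec, dotProduct, rowMatrix, PiLp.inner_apply, mul_comm]

theorem toEuclideanLin_single {k n : ℕ} (Γ : Matrix (Fin k) (Fin n) ℝ) :
    (fun j => Γ.toEuclideanLin (EuclideanSpace.single j 1)) = columnVector Γ := by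
  ext j i
  simp [columnVector]

theorem exists_measurableSet_hasNeighborlyHulls {k n : ℕ} (hk : 1 ≤ k) (hkn : k ≤ n) {α : ℝ}
    (hα : 1 ≤ α) {μ : Measure (EuclideanSpace ℝ (Fin n))} (hiso : IsIsotropicMeasure μ)
    (hpsi : IsPsiTwoMeasure μ α) {Ω : Type*} [MeasurableSpace Ω] {P : Measure Ω}
    [IsProbabilityMeasure P] {X : Fin k → Ω → EuclideanSpace ℝ (Fin n)} (hindep : iIndepFun X P)
    (hlaw : ∀ i, HasLaw (X i) μ P) :
    ∃ A : Set Ω, MeasurableSet A ∧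
      1 - Real.exp (-(1 / 4096 * k / α ^ 4)) ≤ P.real A ∧
      ∀ ω ∈ A, ∀ m : ℕ,
        (m : ℝ) ≤ 1 / 294912 * k / (α ^ 4 * Real.log (1048576 * n * α ^ 4 / k)) →
        HasNeighborlyHulls m (rowMatrix fun i => X i ω) := by
  have hk0 : (0 : ℝ) < k := by exact_mod_cast hk
  have hα4 : 1 ≤ α ^ 4 := one_le_pow₀ hα
  have hα0 : 0 < α ^ 4 := by linarith
  set K : ℝ := k / α ^ 4 with hK
  set L := Real.log (1048576 * n / K) with hL
  have hK0 : 0 < K := by positivity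
  have hKn : K ≤ n := (div_le_self hk0.le hα4).trans (by exact_mod_cast hkn)
  have e1 : 1 / 294912 * k / (α ^ 4 * Real.log (1048576 * n * α ^ 4 / k)) =
      1 / 294912 * K / L := by
    have : 1048576 * n * α ^ 4 / k = 1048576 * n / K := by rw [hK]; field_simp
    rw [this, ← hL, ← div_div, hK, mul_div_assoc]
  have e2 : 1 / 4096 * k / α ^ 4 = K / 4096 := by rw [hK]; ring
  rw [e1, e2]
  -- Below the threshold `2` only `m ≤ 1` is admissible and the whole space serves as the event.
  -- Otherwise the largest admissible `M` gives one event for all `m ≤ M`.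
  by_cases h2 : 2 ≤ 1 / 294912 * K / L
  · set M := ⌊1 / 294912 * K / L⌋₊ with hM
    have hcard := two_mul_card_sym_le hK0 hKn hL h2
    rw [← hM] at hcard
    set bad : Sym (Fin n × Bool) (18 * M) → Set Ω := fun s =>
      {ω | ∑ i, inner ℝ (X i ω) (signedSum (s : Multiset (Fin n × Bool))) ^ 2 <
          k / 2 * ‖signedSum (s : Multiset (Fin n × Bool))‖ ^ 2 ∨
        2 * k * ‖signedSum (s : Multiset (Fin n × Bool))‖ ^ 2 <
          ∑ i, inner ℝ (X i ω) (signedSum (s : Multiset (Fin n × Bool))) ^ 2} with hbad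
    have hPbad : P.real (⋃ s, bad s) ≤ Real.exp (-(K / 4096)) := by
      calc P.real (⋃ s, bad s) ≤ ∑ s, P.real (bad s) := measureReal_iUnion_fintype_le _
        _ ≤ ∑ s : Sym (Fin n × Bool) (18 * M), 2 * Real.exp (-(k / (2048 * α ^ 4))) :=
            Finset.sum_le_sum fun s _ =>
              measureReal_sum_inner_sq_le hα hiso hpsi hindep hlaw _
        _ = 2 * Fintype.card (Sym (Fin n × Bool) (18 * M)) * Real.exp (-(K / 2048)) := by
            have : (k : ℝ) / (2048 * α ^ 4) = K / 2048 := by rw [hK, mul_comm, div_div]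
            rw [Finset.sum_const, Finset.card_univ, nsmul_eq_mul, this]
            ring
        _ ≤ Real.exp (K / 4096) * Real.exp (-(K / 2048)) := by gcongr
        _ = Real.exp (-(K / 4096)) := by rw [← Real.exp_add]; ring_nf
    -- The variables are only almost everywhere measurable, so the bad event is replaced by a
    -- measurable superset of equal measure.
    refine ⟨(toMeasurable P (⋃ s, bad s))ᶜ, (measurableSet_toMeasurable _ _).compl, ?_, ?_⟩
    · rw [probReal_compl_eq_one_sub (measurableSet_toMeasurable _ _)]
      have : P.real (toMeasurable P (⋃ s, bad s)) = P.real (⋃ s, bad s) := by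
        simp [measureReal_def, measure_toMeasurable]
      linarith
    · intro ω hω m hm
      have hmM : m ≤ M := Nat.le_floor hm
      have hM1 : 2 ≤ M := Nat.le_floor (by exact_mod_cast h2)
      have hgood : ∀ s : Multiset (Fin n × Bool), s.card = 18 * M →
          k / 2 * ‖signedSum s‖ ^ 2 ≤
              ‖(rowMatrix fun i => X i ω).toEuclideanLin (signedSum s)‖ ^ 2 ∧
            ‖(rowMatrix fun i => X i ω).toEuclideanLin (signedSum s)‖ ^ 2 ≤
              2 * k * ‖signedSum s‖ ^ 2 := by
        intro s hs
        have hns : ω ∉ bad ⟨s, hs⟩ := fun h =>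
          hω (subset_toMeasurable P _ (Set.mem_iUnion.2 ⟨⟨s, hs⟩, h⟩))
        simp only [hbad, Set.mem_ofPred_eq, not_or, not_lt] at hns
        rw [norm_sq_toEuclideanLin_rowMatrix]
        exact hns
      -- The condition `16 * M < 18 * M` needs `M` to be positive.
      have hnsp := hasNullSpaceProperty_of_signedSum (m := M)
        (rowMatrix fun i => X i ω).toEuclideanLin hk0 (by omega)
        (fun s hs => (hgood s hs).1) (fun s hs => (hgood s hs).2)
      rw [toEuclideanLin_single] at hnsp
      exact (hnsp.mono hmM).hasNeighborlyHulls
  · refine ⟨Set.univ, MeasurableSet.univ, ?_, fun ω _ m hm => ?_⟩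
    · rw [probReal_univ]
      linarith [Real.exp_pos (-(K / 4096))]
    · have : (m : ℝ) < 2 := hm.trans_lt (not_le.1 h2)
      exact hasNeighborlyHulls_of_le_one (by have : m < 2 := by exact_mod_cast this
                                             omega) _

theorem mainTheorem6 :
    -- general isotropic `ψ₂` matrices
    (∃ c C c' : ℝ, 1 < c ∧ 0 < C ∧ 0 < c' ∧
      ∀ (k n : ℕ), 1 ≤ k → k ≤ n →
      ∀ (α : ℝ), 1 ≤ α →
      ∀ (μ : Measure (EuclideanSpace ℝ (Fin n))) [IsProbabilityMeasure μ],
        IsIsotropicMeasure μ → IsPsiTwoMeasure μ α →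
      ∀ (Ω : Type*) [MeasurableSpace Ω] (P : Measure Ω) [IsProbabilityMeasure P]
        (X : Fin k → Ω → EuclideanSpace ℝ (Fin n)),
        iIndepFun X P → (∀ i, HasLaw (X i) μ P) →
      ∃ A : Set Ω, MeasurableSet A ∧
        1 - Real.exp (-(c' * k / α ^ 4)) ≤ P.real A ∧
        ∀ ω ∈ A, ∀ m : ℕ,
          (m : ℝ) ≤ C * k / (α ^ 4 * Real.log (c * n * α ^ 4 / k)) →
          HasNeighborlyHulls m (rowMatrix fun i => X i ω)) ∧
    -- random sign matrices are of this kind, with an absolute constant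
    (∃ α : ℝ, 1 ≤ α ∧ ∀ n : ℕ, IsProbabilityMeasure (signCubeMeasure n) ∧
      IsIsotropicMeasure (signCubeMeasure n) ∧ IsPsiTwoMeasure (signCubeMeasure n) α) ∧
    -- random sign matrices
    (∃ c₁ c₂ c₃ : ℝ, 0 < c₁ ∧ 0 < c₂ ∧ 1 < c₃ ∧
      ∀ (k n : ℕ), 1 ≤ k → k ≤ n →
      ∀ (Ω : Type*) [MeasurableSpace Ω] (P : Measure Ω) [IsProbabilityMeasure P]
        (X : Fin k → Ω → EuclideanSpace ℝ (Fin n)),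
        iIndepFun X P → (∀ i, HasLaw (X i) (signCubeMeasure n) P) →
      ∃ A : Set Ω, MeasurableSet A ∧
        1 - Real.exp (-(c₁ * k)) < P.real A ∧
        ∀ ω ∈ A, ∀ m : ℕ,
          (m : ℝ) ≤ c₂ * k / Real.log (c₃ * n / k) →
          HasNeighborlyHulls m (rowMatrix fun i => X i ω)) := by
  refine ⟨⟨1048576, 1 / 294912, 1 / 4096, by norm_num, by norm_num, by norm_num, ?_⟩,
    ⟨2, by norm_num, fun n => ⟨isProbabilityMeasure_signCubeMeasure n,
      isIsotropicMeasure_signCubeMeasure, isPsiTwoMeasure_signCubeMeasure⟩⟩,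
    -- Specialization to `α = 2`, so `α⁴ = 2⁴`. The first constant is half of `1 / 4096 / 2⁴`, which
    -- turns the probability bound into a strict one.
    ⟨1 / 131072, 1 / 294912 / 2 ^ 4, 1048576 * 2 ^ 4, by norm_num, by norm_num, by norm_num, ?_⟩⟩
  · intro k n hk hkn α hα μ _ hiso hpsi Ω _ P _ X hindep hlaw
    exact exists_measurableSet_hasNeighborlyHulls hk hkn hα hiso hpsi hindep hlaw
  · intro k n hk hkn Ω _ P _ X hindep hlaw
    have hk0 : (0 : ℝ) < k := by exact_mod_cast hk
    obtain ⟨A, hA, hP, h⟩ := exists_measurableSet_hasNeighborlyHulls hk hkn one_le_two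
      isIsotropicMeasure_signCubeMeasure isPsiTwoMeasure_signCubeMeasure hindep hlaw
    refine ⟨A, hA, lt_of_lt_of_le ?_ hP, fun ω hω m hm => h ω hω m (hm.trans_eq ?_)⟩
    · rw [sub_lt_sub_iff_left, Real.exp_lt_exp]
      linarith
    · rw [mul_right_comm (1048576 : ℝ) (2 ^ 4) (n : ℝ), ← div_div]
      ring
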